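/- For $z\in\mathbb Z^2$ let $C_z=z+[-\tfrac12,\tfrac12]^2$, and for a finite set $A\subset\mathbb Z^2$ let $\square A=\bigcup_{z\in A}C_z$. Let $\mu_1$ be the Euclidean motion invariant Radon measure on the space of lines in $\mathbb R^2$, normalized so that the set of lines meeting the unit disc has measure $2$. For a set $K$ write $[K]$ for the set of lines meeting $K$. Fix a measurable choice of a unit direction vector $v_L$ for every line $L$. For a line $L$ let $L^A=\{z\in A: C_z\cap L\neq\emptyset\}$, and let $\min(L^A)$ and $\max(L^A)$ be the first and the last point of $L^A$ in the order in which the boxes $C_z$ are first hit when $L$ is traversed in direction $v_L$ (ties are broken lexicographically). For finite nonempty $A\subset\mathbb Z^2$, the *ballistic measure* $b_A$ on $A$ is $$b_A(z)=\frac1{\mu_1([\square A])}\int_{[\square A]}b_A(z,L)\,\mu_1(dL),$$ where $b_A(z,L)=1$ if $L^A=\{z\}$, $b_A(z,L)=\tfrac12$ if $\#L^A>1$ and $z\in\{\min(L^A),\max(L^A)\}$, and $b_A(z,L)=0$ otherwise. *Ballistic aggregation* in $\mathbb Z^2$ is a sequence $(F_n)_{n\ge1}$ of random finite subsets of $\mathbb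 Z^2$, on some probability space, such that $F_1=\{0\}$ and, for every $n\ge1$, $F_{n+1}=F_n\cup\{y_{n+1}\}$, where $y_{n+1}$ is a random point of $\mathbb Z^2$ with $$\mathbb P(y_{n+1}=y\mid F_n=A)=b_{\partial A}(y)$$ for all $y\in\mathbb Z^2$ and all finite $A$ with $\mathbb P(F_n=A)>0$. Here $\partial A=\{y\in\mathbb Z^2\setminus A:\ \|x-y\|=1\text{ for some }x\in A\}$. Let $\mathrm{rad}(A)=\max_{x\in A}\|x\|$ (Euclidean norm). **Corollary.** Let $(F_n)_{n\ge1}$ be ballistic aggregation in $\mathbb Z^2$. Then almost surely the fractal dimension $$\delta_f=\lim_{n\to\infty}\frac{\log(\#F_n)}{\log(\mathrm{rad}(F_n))}$$ exists and equals $2$; likewise, almost surely, $\lim_{n\to\infty}\log n/\log(\mathrm{rad}(F_n))=2$. -/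

import Mathlib

open MeasureTheory ProbabilityTheory Filter Topology
open scoped ENNReal NNReal

namespace BallisticAggregation

/-! ## The lattice, radius, outer boundary -/

/-- The integer lattice `ℤ^d`. -/
abbrev Lattice (d : ℕ) : Type := Fin d → ℤ

/-- Euclidean space `ℝ^d`. -/
abbrev Space (d : ℕ) : Type := EuclideanSpace ℝ (Fin d)

/-- The natural embedding `ℤ^d ⊆ ℝ^d`. -/
noncomputable def embed {d : ℕ} (z : Lattice d) : Space d :=
  WithLp.toLp 2 (fun i => (z i : ℝ))

/-- Nearest neighbours in `ℤ^d`: Euclidean distance one. -/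
def Adj {d : ℕ} (x y : Lattice d) : Prop := ‖embed x - embed y‖ = 1

theorem finite_outerBoundary {d : ℕ} (A : Finset (Lattice d)) :
    {y : Lattice d | y ∉ A ∧ ∃ x ∈ A, Adj x y}.Finite := by
  refine Set.Finite.subset
    (Set.Finite.biUnion A.finite_toSet (fun x _ => Set.finite_Icc (x - 1) (x + 1))) ?_
  rintro y ⟨-, x, hx, hxy⟩
  refine Set.mem_biUnion (Finset.mem_coe.2 hx) ?_
  have key : ∀ i, |((x i - y i : ℤ) : ℝ)| ≤ 1 := fun i => by
    have h := PiLp.norm_apply_le (embed x - embed y) i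
    rw [hxy] at h
    simpa [embed] using h
  have key' : ∀ i, |x i - y i| ≤ 1 := fun i => by exact_mod_cast key i
  constructor <;> intro i <;> have h := abs_le.1 (key' i) <;> simp <;> omega

/-- The outer boundary `∂A`: the lattice points outside `A` that have a neighbour in `A`. -/
noncomputable def outerBoundary {d : ℕ} (A : Finset (Lattice d)) : Finset (Lattice d) :=
  (finite_outerBoundary A).toFinset

/-- The radius `max_{x ∈ A} ‖x‖`. -/
noncomputable def rad {d : ℕ} (A : Finset (Lattice d)) : ℝ :=
  ((A.sup fun x => ‖embed x‖₊ : ℝ≥0) : ℝ)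

/-- The fractal dimension `lim log #Aₙ / log rad Aₙ` of the sequence exists and equals `δ`. -/
def HasFractalDimension {d : ℕ} (A : ℕ → Finset (Lattice d)) (δ : ℝ) : Prop :=
  Tendsto (fun n => Real.log ((A n).card : ℝ) / Real.log (rad (A n))) atTop (𝓝 δ)

/-! ## Incremental aggregation -/

/-- `(F n)_{n ≥ 1}` is incremental aggregation for the family of point masses `μ A z = μ_A({z})`
(only indices `n ≥ 1` matter). -/
structure IsIncrementalAggregation {d : ℕ} (μ : Finset (Lattice d) → Lattice d → ℝ≥0∞)
    {Ω : Type*} [MeasurableSpace Ω] (P : Measure Ω) (F : ℕ → Ω → Finset (Lattice d)) : Prop where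
  /-- Each `F n` is a random finite set, for the discrete σ-algebra on finite sets. -/
  measurable : ∀ n, 1 ≤ n → Measurable[inferInstance, ⊤] (F n)
  start : ∀ ω, F 1 ω = {0}
  /-- `F (n + 1)` is `F n` with one random point added, whose conditional distribution given
  `F n = A` is `μ (∂A)`. -/
  step : ∀ n, 1 ≤ n → ∃ y : Ω → Lattice d, Measurable y ∧
    (∀ ω, F (n + 1) ω = insert (y ω) (F n ω)) ∧
    ∀ A : Finset (Lattice d), P {ω | F n ω = A} ≠ 0 →
      ∀ z : Lattice d, P[{ω | y ω = z} | {ω | F n ω = A}] = μ (outerBoundary A) z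

/-! ## Lines and the invariant line measure in the plane -/

/-- The space of lines (one-dimensional affine subspaces) of `ℝ^d`. -/
def Line (d : ℕ) : Type :=
  {L : AffineSubspace ℝ (Space d) // Module.finrank ℝ L.direction = 1}

/-- The set of points on a line. -/
def Line.points {d : ℕ} (L : Line d) : Set (Space d) := (L.1 : Set (Space d))

/-- The set `[K]` of lines meeting `K`. -/
def hitting {d : ℕ} (K : Set (Space d)) : Set (Line d) := {L | (L.points ∩ K).Nonempty}

/-- The σ-algebra generated by the sets `[K]`, with `K` compact and convex. -/
instance {d : ℕ} : MeasurableSpace (Line d) :=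
  MeasurableSpace.generateFrom
    {S | ∃ K : Set (Space d), IsCompact K ∧ Convex ℝ K ∧ S = hitting K}

/-- The line `{x | x₀ cos θ + x₁ sin θ = p}` with unit normal `(cos θ, sin θ)` at signed distance
`p` from the origin. -/
noncomputable def lineOf (q : ℝ × ℝ) : Line 2 :=
  ⟨AffineSubspace.mk' (q.2 • (!₂[Real.cos q.1, Real.sin q.1] : Space 2))
      (Submodule.span ℝ {(!₂[-Real.sin q.1, Real.cos q.1] : Space 2)}), by
    rw [AffineSubspace.direction_mk']
    refine finrank_span_singleton fun h => ?_
    have h0 := congrArg (fun x : Space 2 => x 0) h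
    have h1 := congrArg (fun x : Space 2 => x 1) h
    simp at h0 h1
    have := Real.sin_sq_add_cos_sq q.1
    simp [h0, h1] at this⟩

theorem mem_lineOf (q : ℝ × ℝ) (x : Space 2) :
    x ∈ (lineOf q).points ↔ x 0 * Real.cos q.1 + x 1 * Real.sin q.1 = q.2 := by
  have hsc := Real.sin_sq_add_cos_sq q.1
  simp only [Line.points, lineOf, SetLike.mem_coe, AffineSubspace.mem_mk', vsub_eq_sub,
    Submodule.mem_span_singleton]
  constructor
  · rintro ⟨t, ht⟩
    have h0 := congrArg (fun x : Space 2 => x 0) ht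
    have h1 := congrArg (fun x : Space 2 => x 1) ht
    simp at h0 h1
    linear_combination (-Real.cos q.1) * h0 - Real.sin q.1 * h1 + q.2 * hsc
  · intro h
    refine ⟨-x 0 * Real.sin q.1 + x 1 * Real.cos q.1, ?_⟩
    ext i
    fin_cases i
    · simp
      linear_combination (-Real.cos q.1) * h + x 0 * hsc
    · simp
      linear_combination (-Real.sin q.1) * h + x 1 * hsc

theorem measurable_lineOf : Measurable lineOf := by
  refine measurable_generateFrom ?_
  rintro _ ⟨K, hK, -, rfl⟩
  have hcl : IsClosed {z : (ℝ × ℝ) × Space 2 |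
      z.2 0 * Real.cos z.1.1 + z.2 1 * Real.sin z.1.1 = z.1.2} :=
    isClosed_eq (by fun_prop) (by fun_prop)
  have : CompactSpace K := isCompact_iff_compactSpace.1 hK
  have himg := isClosedMap_fst_of_compactSpace (Y := K) _
    (hcl.preimage (f := fun z : (ℝ × ℝ) × K => (z.1, (z.2 : Space 2))) (by fun_prop))
  have heq : lineOf ⁻¹' hitting K = Prod.fst '' ((fun z : (ℝ × ℝ) × K => (z.1, (z.2 : Space 2))) ⁻¹'
      {z : (ℝ × ℝ) × Space 2 |
        z.2 0 * Real.cos z.1.1 + z.2 1 * Real.sin z.1.1 = z.1.2}) := by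
    ext q
    constructor
    · rintro ⟨x, hx, hxK⟩
      exact ⟨(q, ⟨x, hxK⟩), (mem_lineOf _ _).1 hx, rfl⟩
    · rintro ⟨⟨q', x⟩, hx, rfl⟩
      exact ⟨x, (mem_lineOf _ _).2 hx, x.2⟩
  rw [heq]
  exact himg.measurableSet

/-- The motion-invariant measure `μ₁` on the lines of the plane, normalized so that the lines
meeting the unit disc have measure `κ₁ = 2`: the image of `π⁻¹ dθ dp` on `[0, π) × ℝ` under
`lineOf`, which is a bijection of `[0, π) × ℝ` onto the space of lines. -/
noncomputable def lineMeasure : Measure (Line 2) :=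
  (ENNReal.ofReal Real.pi)⁻¹ •
    Measure.map lineOf
      ((volume.restrict (Set.Ico (0 : ℝ) Real.pi)).prod (volume : Measure ℝ))

/-- The law of an isotropic random line through `K`: `𝒜 ↦ μ₁(𝒜 ∩ [K]) / μ₁([K])`. -/
noncomputable def isotropicLaw (K : Set (Space 2)) : Measure (Line 2) :=
  ProbabilityTheory.cond lineMeasure (hitting K)

/-! ## The ballistic measure -/

/-- The closed unit cube `C_z` centered at `z`. -/
def box {d : ℕ} (z : Lattice d) : Set (Space d) :=
  {x | ∀ i, |x i - (z i : ℝ)| ≤ 1 / 2}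

/-- The union `□A` of the boxes centered in `A`. -/
def boxes {d : ℕ} (A : Finset (Lattice d)) : Set (Space d) := ⋃ z ∈ A, box z

/-- A measurable choice of a unit direction vector for every line. -/
structure IsDirectionField {d : ℕ} (v : Line d → Space d) : Prop where
  measurable : Measurable v
  norm_eq_one : ∀ L, ‖v L‖ = 1
  mem_direction : ∀ L, v L ∈ L.1.direction

open Classical in
/-- The set `L^A` of the points of `A` whose boxes are met by `L`. -/
noncomputable def visited {d : ℕ} (A : Finset (Lattice d)) (L : Line d) : Finset (Lattice d) :=
  A.filter fun z => (L.points ∩ box z).Nonempty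

/-- The place of `z` in the order in which the boxes are visited when `L` is traversed in direction
`v L`: the arc length coordinate `⟨v L, x⟩` at which the box is first hit, ties being broken by
the lexicographic order of the lattice. -/
noncomputable def visitKey {d : ℕ} (v : Line d → Space d) (L : Line d) (z : Lattice d) :
    ℝ ×ₗ Lex (Lattice d) :=
  toLex (sInf ((fun x => inner ℝ (v L) x) '' (L.points ∩ box z)), toLex z)

/-- `z = min (L^A)`. -/
def IsFirst {d : ℕ} (v : Line d → Space d) (A : Finset (Lattice d)) (L : Line d)
    (z : Lattice d) : Prop :=
  z ∈ visited A L ∧ ∀ w ∈ visited A L, visitKey v L z ≤ visitKey v L w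

/-- `z = max (L^A)`. -/
def IsLast {d : ℕ} (v : Line d → Space d) (A : Finset (Lattice d)) (L : Line d)
    (z : Lattice d) : Prop :=
  z ∈ visited A L ∧ ∀ w ∈ visited A L, visitKey v L w ≤ visitKey v L z

open Classical in
/-- The weight `b_A(z, L)`. -/
noncomputable def weight {d : ℕ} (v : Line d → Space d) (A : Finset (Lattice d)) (z : Lattice d)
    (L : Line d) : ℝ≥0∞ :=
  if visited A L = {z} then 1
  else if 1 < (visited A L).card ∧ (IsFirst v A L z ∨ IsLast v A L z) then 1 / 2
  else 0

/-- The point masses `b_A(z)` of the ballistic measure on `A ⊆ ℤ²`. -/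
noncomputable def ballisticMeasure (v : Line 2 → Space 2) (A : Finset (Lattice 2))
    (z : Lattice 2) : ℝ≥0∞ :=
  ∫⁻ L, weight v A z L ∂(isotropicLaw (boxes A))

/-- Ballistic aggregation in `ℤ²`. -/
def IsBallisticAggregation (v : Line 2 → Space 2) {Ω : Type*} [MeasurableSpace Ω]
    (P : Measure Ω) (F : ℕ → Ω → Finset (Lattice 2)) : Prop :=
  IsIncrementalAggregation (ballisticMeasure v) P F

end BallisticAggregation

namespace BallisticAggregation

/-! ## Boxes and neighbours -/

/-! Almost surely `F n` has exactly `n` points, so it suffices to bound its radius above and below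
by constant multiples of `√n`. The lower bound is deterministic: `n` lattice points need a square of
side of order `√n` (`sqrt_card_le_rad`).

For the upper bound, a connected cluster `A` of `n` points containing the origin extends to distance
of order `√n`, so the lines meeting it have measure at least `√n / 64`. Each of them also meets the
boundary boxes (`le_lineMeasure_hitting_outerBoundary`). Lines through a single box have measure at
most `2`, hence every boundary point has ballistic mass at most `128 / √n`, whatever the shape of
`A` (`ballisticMeasure_outerBoundary_le`).

This uniform bound controls `expSum`: the new point is a neighbour of the cluster, so one step
multiplies the expectation by at most `1 + C / √n`. Iterating gives `exp (O(√n))`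
(`lintegral_expSum_le`), and Markov's inequality with Borel–Cantelli yields `rad (F n) = O(√n)`
almost surely. -/

theorem embed_apply {d : ℕ} (z : Lattice d) (i : Fin d) : embed z i = (z i : ℝ) := rfl

theorem adj_iff (x y : Lattice 2) : Adj x y ↔ (x 0 - y 0) ^ 2 + (x 1 - y 1) ^ 2 = 1 := by
  have h : ‖embed x - embed y‖ ^ 2 = (((x 0 - y 0) ^ 2 + (x 1 - y 1) ^ 2 : ℤ) : ℝ) := by
    rw [EuclideanSpace.real_norm_sq_eq]
    simp [Fin.sum_univ_two, embed_apply]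
  rw [Adj, ← sq_eq_sq₀ (norm_nonneg _) zero_le_one, h]
  norm_cast

theorem mem_outerBoundary {d : ℕ} {A : Finset (Lattice d)} {y : Lattice d} :
    y ∈ outerBoundary A ↔ y ∉ A ∧ ∃ x ∈ A, Adj x y := by
  simp [outerBoundary]

theorem embed_mem_box {d : ℕ} (z : Lattice d) : embed z ∈ box z := fun i => by
  simp [embed_apply]

theorem isClosed_box {d : ℕ} (z : Lattice d) : IsClosed (box z) := by
  simp only [box, Set.ofPred_forall]
  exact isClosed_iInter fun i => isClosed_le (by fun_prop) continuous_const

theorem convex_box {d : ℕ} (z : Lattice d) : Convex ℝ (box z) := by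
  intro x hx y hy a b ha hb hab i
  have h1 := abs_le.1 (hx i)
  have h2 := abs_le.1 (hy i)
  have hb' : b = 1 - a := by linarith
  subst hb'
  simp only [PiLp.add_apply, PiLp.smul_apply, smul_eq_mul]
  rw [abs_le]
  constructor <;> nlinarith

theorem isCompact_box {d : ℕ} (z : Lattice d) : IsCompact (box z) := by
  have h : box z = (EuclideanSpace.equiv (Fin d) ℝ).toHomeomorph ⁻¹'
      (Set.univ.pi fun i => Set.Icc ((z i : ℝ) - 1 / 2) ((z i : ℝ) + 1 / 2)) := by
    ext x
    simp only [box, Set.mem_ofPred_eq, Set.mem_preimage, Set.mem_univ_pi, Set.mem_Icc, abs_le]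
    refine forall_congr' fun i => ?_
    change _ ↔ (z i : ℝ) - 1 / 2 ≤ x i ∧ x i ≤ (z i : ℝ) + 1 / 2
    constructor <;> rintro ⟨h1, h2⟩ <;> constructor <;> linarith
  rw [h, Homeomorph.isCompact_preimage]
  exact isCompact_univ_pi fun _ => isCompact_Icc

theorem mem_boxes {d : ℕ} {A : Finset (Lattice d)} {x : Space d} :
    x ∈ boxes A ↔ ∃ z ∈ A, x ∈ box z := by
  simp [boxes]

theorem isClosed_boxes {d : ℕ} (A : Finset (Lattice d)) : IsClosed (boxes A) :=
  A.finite_toSet.isClosed_biUnion fun z _ => isClosed_box z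

/-- Boxes sharing a point have centers at supremum distance at most one. -/
theorem abs_sub_le_one_of_mem_box {d : ℕ} {z w : Lattice d} {x : Space d} (hz : x ∈ box z)
    (hw : x ∈ box w) (i : Fin d) : |z i - w i| ≤ 1 := by
  have h1 := abs_le.1 (hz i)
  have h2 := abs_le.1 (hw i)
  have : |(z i : ℝ) - w i| ≤ 1 := abs_le.2 ⟨by linarith, by linarith⟩
  exact_mod_cast this

theorem locallyFinite_box {d : ℕ} : LocallyFinite (box : Lattice d → Set (Space d)) := by
  intro x
  refine ⟨Metric.ball x (1 / 2), Metric.ball_mem_nhds x (by norm_num),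
    (Set.finite_Icc (fun i => ⌊x i⌋ - 1) (fun i => ⌊x i⌋ + 2)).subset ?_⟩
  rintro z ⟨y, hyz, hyx⟩
  have key : ∀ i, |x i - z i| < 1 := fun i => by
    have h1 : |y i - x i| < 1 / 2 := by
      have := PiLp.norm_apply_le (y - x) i
      rw [← dist_eq_norm] at this
      exact lt_of_le_of_lt (by simpa using this) hyx
    have h2 := hyz i
    rw [abs_lt] at *
    rw [abs_le] at h2
    constructor <;> linarith
  constructor <;> intro i
  · have := (abs_lt.1 (key i)).2
    have h3 : ((⌊x i⌋ : ℤ) : ℝ) < ((z i + 1 : ℤ) : ℝ) := by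
      push_cast
      linarith [Int.floor_le (x i)]
    have := Int.cast_lt.1 h3
    simp only
    omega
  · have := (abs_lt.1 (key i)).1
    have h3 : ((z i : ℤ) : ℝ) < ((⌊x i⌋ + 2 : ℤ) : ℝ) := by
      push_cast
      linarith [Int.lt_floor_add_one (x i)]
    have := Int.cast_lt.1 h3
    simp only
    omega

theorem exists_mem_box {d : ℕ} (x : Space d) : ∃ z : Lattice d, x ∈ box z :=
  ⟨fun i => round (x i), fun i => abs_sub_round (x i)⟩

/-- A common point of a box of `A` and a box outside `A` lies in a box of the outer boundary. -/
theorem mem_boxes_outerBoundary {A : Finset (Lattice 2)} {z w : Lattice 2} {x : Space 2}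
    (hz : z ∈ A) (hw : w ∉ A) (hxz : x ∈ box z) (hxw : x ∈ box w) :
    x ∈ boxes (outerBoundary A) := by
  have hd := abs_sub_le_one_of_mem_box hxz hxw
  have sq_one : ∀ {a : ℤ}, |a| ≤ 1 → a ≠ 0 → a ^ 2 = 1 := fun {a} h h0 => by
    have := abs_le.1 h
    obtain rfl | rfl : a = 1 ∨ a = -1 := by omega
    all_goals norm_num
  -- The two boxes may touch only at a corner. The mixed point `u` equals or is adjacent to each of
  -- `z` and `w`, so either `w` or `u` is a boundary point, according to whether `u` lies in `A`.
  let u : Lattice 2 := ![w 0, z 1]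
  have hxu : x ∈ box u := by
    intro i
    fin_cases i
    · exact hxw 0
    · exact hxz 1
  by_cases hu : u ∈ A
  · refine mem_boxes.2 ⟨w, mem_outerBoundary.2 ⟨hw, u, hu, (adj_iff _ _).2 ?_⟩, hxw⟩
    have hne : z 1 - w 1 ≠ 0 := fun h => hw <| by
      have : w = u := by
        ext i
        fin_cases i
        · rfl
        · simp only [u, Fin.mk_one, Matrix.cons_val_one, Matrix.cons_val_fin_one]
          omega
      rwa [this]
    simp [u, sq_one (hd 1) hne]
  · refine mem_boxes.2 ⟨u, mem_outerBoundary.2 ⟨hu, z, hz, (adj_iff _ _).2 ?_⟩, hxu⟩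
    have hne : z 0 - w 0 ≠ 0 := fun h => hu <| by
      have : u = z := by
        ext i
        fin_cases i
        · simp only [u, Fin.zero_eta, Matrix.cons_val_zero]
          omega
        · rfl
      rwa [this]
    simp [u, sq_one (hd 0) hne]

theorem exists_bound_boxes {d : ℕ} (A : Finset (Lattice d)) :
    ∃ M : ℝ, 0 ≤ M ∧ ∀ x ∈ boxes A, ∀ i, |x i| ≤ M := by
  have hc : IsCompact (boxes A) := A.finite_toSet.isCompact_biUnion fun z _ => isCompact_box z
  obtain ⟨M, hM, h⟩ := hc.isBounded.exists_pos_norm_le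
  exact ⟨M, hM.le, fun x hx i => (PiLp.norm_apply_le x i).trans (h x hx)⟩

/-- A line meeting a box of `A` also meets a box of the outer boundary of `A`. -/
theorem lineOf_mem_hitting_outerBoundary {A : Finset (Lattice 2)} {q : ℝ × ℝ}
    (h : lineOf q ∈ hitting (boxes A)) : lineOf q ∈ hitting (boxes (outerBoundary A)) := by
  have hconn : IsPreconnected (lineOf q).points :=
    (AffineSubspace.convex (lineOf q).1).isPreconnected
  let B : Set (Space 2) := ⋃ z : {z : Lattice 2 // z ∉ A}, box z.1
  have hB : IsClosed B :=
    (locallyFinite_box.comp_injective Subtype.val_injective).isClosed_iUnion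
      fun z => isClosed_box z.1
  have hcover : (lineOf q).points ⊆ boxes A ∪ B := fun x _ => by
    obtain ⟨z, hz⟩ := exists_mem_box x
    by_cases hzA : z ∈ A
    · exact Or.inl (mem_boxes.2 ⟨z, hzA, hz⟩)
    · exact Or.inr (Set.mem_iUnion.2 ⟨⟨z, hzA⟩, hz⟩)
  have hout : ((lineOf q).points ∩ B).Nonempty := by
    obtain ⟨M, hM, hbd⟩ := exists_bound_boxes A
    -- The point at distance `2 * M + 1` along the line from the foot of the perpendicular; its
    -- squared norm exceeds `2 * M ^ 2`, so it is outside `boxes A`.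
    let x : Space 2 := !₂[q.2 * Real.cos q.1 - (2 * M + 1) * Real.sin q.1,
      q.2 * Real.sin q.1 + (2 * M + 1) * Real.cos q.1]
    have hsc := Real.sin_sq_add_cos_sq q.1
    have hx : x ∈ (lineOf q).points := by
      rw [mem_lineOf]
      simp only [x, Matrix.cons_val_zero, Matrix.cons_val_one,
        Matrix.cons_val_fin_one]
      linear_combination q.2 * hsc
    refine ⟨x, hx, (hcover hx).resolve_left fun hxA => ?_⟩
    have h0 := sq_le_sq' (abs_le.1 (hbd x hxA 0)).1 (abs_le.1 (hbd x hxA 0)).2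
    have h1 := sq_le_sq' (abs_le.1 (hbd x hxA 1)).1 (abs_le.1 (hbd x hxA 1)).2
    have hn : x 0 ^ 2 + x 1 ^ 2 = q.2 ^ 2 + (2 * M + 1) ^ 2 := by
      simp only [x, Matrix.cons_val_zero, Matrix.cons_val_one,
        Matrix.cons_val_fin_one]
      linear_combination (q.2 ^ 2 + (2 * M + 1) ^ 2) * hsc
    nlinarith [sq_nonneg q.2]
  -- A connected line covered by two closed sets and meeting both must meet their intersection.
  obtain ⟨x, hxL, hxA, hxB⟩ := isPreconnected_closed_iff.1 hconn _ _ (isClosed_boxes A) hB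
    hcover h hout
  obtain ⟨z, hz, hxz⟩ := mem_boxes.1 hxA
  obtain ⟨⟨w, hw⟩, hxw⟩ := Set.mem_iUnion.1 hxB
  exact ⟨x, hxL, mem_boxes_outerBoundary hz hw hxz hxw⟩

/-! ## Connected clusters -/

theorem isPreconnected_boxes_insert {A : Finset (Lattice 2)} {y : Lattice 2}
    (hA : IsPreconnected (boxes A)) (hy : y ∈ outerBoundary A) :
    IsPreconnected (boxes (insert y A)) := by
  obtain ⟨-, x, hx, hxy⟩ := mem_outerBoundary.1 hy
  have hins : boxes (insert y A) = box y ∪ boxes A := by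
    simp [boxes]
  rw [hins]
  let m : Space 2 := WithLp.toLp 2 fun i => ((x i : ℝ) + y i) / 2
  have habs : ∀ i, |(x i : ℝ) - y i| ≤ 1 := fun i => by
    have h := PiLp.norm_apply_le (embed x - embed y) i
    rw [hxy] at h
    simpa [embed] using h
  refine IsPreconnected.union m ?_ (mem_boxes.2 ⟨x, hx, ?_⟩) (convex_box y).isPreconnected hA
  all_goals
    intro i
    have := abs_le.1 (habs i)
    rw [abs_le]
    constructor <;> simp only [m] <;> linarith

/-- A planar set of `n` lattice points has a coordinate of size at least `(√n - 1) / 2`, dominating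
all the others. -/
theorem exists_max_coordinate {A : Finset (Lattice 2)} (hA : A.Nonempty) :
    ∃ x ∈ A, ∃ i, (∀ w ∈ A, ∀ j, |w j| ≤ |x i|) ∧
      Real.sqrt A.card ≤ 2 * |(x i : ℝ)| + 1 := by
  obtain ⟨⟨x, i⟩, hx, hmax⟩ := (A ×ˢ (Finset.univ : Finset (Fin 2))).exists_max_image
    (fun p => |p.1 p.2|) (hA.product Finset.univ_nonempty)
  have hmax' : ∀ w ∈ A, ∀ j, |w j| ≤ |x i| := fun w hw j => hmax (w, j) (by simp [hw])
  refine ⟨x, (Finset.mem_product.1 hx).1, i, hmax', ?_⟩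
  have hsub : A ⊆ Fintype.piFinset fun _ : Fin 2 => Finset.Icc (-|x i|) |x i| := fun w hw => by
    simp only [Fintype.mem_piFinset, Finset.mem_Icc]
    exact fun j => abs_le.1 (hmax' w hw j)
  have hcard := Finset.card_le_card hsub
  simp only [Fintype.card_piFinset, Int.card_Icc, Finset.prod_const, Finset.card_univ,
    Fintype.card_fin] at hcard
  refine Real.sqrt_le_iff.2 ⟨by positivity, ?_⟩
  have h2 : ((|x i| + 1 - -|x i|).toNat : ℝ) = 2 * |(x i : ℝ)| + 1 := by
    have : ((|x i| + 1 - -|x i|).toNat : ℤ) = 2 * |x i| + 1 := by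
      rw [Int.toNat_of_nonneg (by linarith [abs_nonneg (x i)])]
      ring
    exact_mod_cast this
  rw [← h2]
  exact_mod_cast hcard

theorem norm_le_rad {d : ℕ} {A : Finset (Lattice d)} {x : Lattice d} (hx : x ∈ A) :
    ‖embed x‖ ≤ rad A := by
  rw [rad, ← coe_nnnorm, NNReal.coe_le_coe]
  exact Finset.le_sup (f := fun x => ‖embed x‖₊) hx

theorem exists_norm_eq_rad {d : ℕ} {A : Finset (Lattice d)} (hA : A.Nonempty) :
    ∃ x ∈ A, ‖embed x‖ = rad A := by
  obtain ⟨x, hx, h⟩ := Finset.exists_mem_eq_sup A hA fun x => ‖embed x‖₊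
  exact ⟨x, hx, by rw [rad, h, coe_nnnorm]⟩

theorem sqrt_card_le_rad {A : Finset (Lattice 2)} (hA : A.Nonempty) :
    (Real.sqrt A.card - 1) / 2 ≤ rad A := by
  obtain ⟨x, hx, i, -, h⟩ := exists_max_coordinate hA
  have h1 : |(x i : ℝ)| ≤ ‖embed x‖ := PiLp.norm_apply_le (embed x) i
  linarith [norm_le_rad hx]

/-- The union of the boxes of `n` lattice points contains a point with a coordinate of size at
least `√n / 2` dominating the other one. -/
theorem exists_far_point {A : Finset (Lattice 2)} (hA : A.Nonempty) :
    ∃ X ∈ boxes A, ∃ i, (∀ j, |X j| ≤ |X i|) ∧ Real.sqrt A.card / 2 ≤ |X i| := by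
  obtain ⟨x, hx, i, hmax, h⟩ := exists_max_coordinate hA
  -- Moving from the center to the outer side of the box absorbs the `+ 1` of
  -- `exists_max_coordinate`, so the bound is useful even for a single point.
  obtain ⟨s, hs, hs'⟩ : ∃ s : ℝ, |s| = 1 / 2 ∧ |(x i : ℝ) + s| = |(x i : ℝ)| + 1 / 2 := by
    rcases le_total 0 (x i : ℝ) with h0 | h0
    · exact ⟨1 / 2, by norm_num, by rw [abs_of_nonneg h0, abs_of_nonneg (by linarith)]⟩
    · exact ⟨-(1 / 2), by norm_num, by
        rw [abs_of_nonpos h0, abs_of_nonpos (by linarith)]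
        ring⟩
  let X : Space 2 := WithLp.toLp 2 fun j => (x j : ℝ) + if j = i then s else 0
  have hXi : |X i| = |(x i : ℝ)| + 1 / 2 := by simpa [X] using hs'
  refine ⟨X, mem_boxes.2 ⟨x, hx, fun j => ?_⟩, i, fun j => ?_, ?_⟩
  · by_cases hj : j = i
    · simp [X, hj, hs]
    · simp [X, hj]
  · by_cases hj : j = i
    · rw [hj]
    · have : |(x j : ℝ)| ≤ |(x i : ℝ)| := by exact_mod_cast hmax x hx j
      rw [hXi]
      simp only [X, hj, if_false, add_zero]
      linarith
  · rw [hXi]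
    linarith

/-! ## Estimates for the line measure -/

theorem measurableSet_hitting_box {d : ℕ} (z : Lattice d) : MeasurableSet (hitting (box z)) :=
  MeasurableSpace.measurableSet_generateFrom ⟨box z, isCompact_box z, convex_box z, rfl⟩

/-- For each normal direction the box projects to within `(|cos θ| + |sin θ|) / 2 ≤ 1` of the
projection `f θ` of its center, so the admissible `p` fill length at most `2`. -/
theorem lineMeasure_hitting_box_le (z : Lattice 2) : lineMeasure (hitting (box z)) ≤ 2 := by
  let f : ℝ → ℝ := fun θ => z 0 * Real.cos θ + z 1 * Real.sin θ
  let S : Set (ℝ × ℝ) := {q | |q.2 - f q.1| ≤ 1}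
  have hS : MeasurableSet S :=
    (isClosed_le (by simp only [f]; fun_prop) continuous_const).measurableSet
  have hsub : lineOf ⁻¹' hitting (box z) ⊆ S := by
    rintro q ⟨x, hx, hxz⟩
    rw [mem_lineOf] at hx
    have h0 := hxz 0
    have h1 := hxz 1
    have hc := Real.abs_cos_le_one q.1
    have hs := Real.abs_sin_le_one q.1
    have heq : q.2 - f q.1 = (x 0 - z 0) * Real.cos q.1 + (x 1 - z 1) * Real.sin q.1 := by
      simp only [f]
      linear_combination -hx
    change |q.2 - f q.1| ≤ 1
    rw [heq]
    refine (abs_add_le _ _).trans ?_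
    rw [abs_mul, abs_mul]
    nlinarith [abs_nonneg (x 0 - z 0), abs_nonneg (x 1 - z 1)]
  have hprod : ((volume.restrict (Set.Ico (0 : ℝ) Real.pi)).prod (volume : Measure ℝ)) S ≤
      2 * ENNReal.ofReal Real.pi := by
    rw [Measure.prod_apply hS]
    calc _ ≤ ∫⁻ _ in Set.Ico (0 : ℝ) Real.pi, 2 := by
          refine lintegral_mono fun θ => ?_
          have : Prod.mk θ ⁻¹' S = Set.Icc (f θ - 1) (f θ + 1) := by
            ext p
            change |p - f θ| ≤ 1 ↔ _
            rw [abs_le, Set.mem_Icc]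
            constructor <;> rintro ⟨h1, h2⟩ <;> constructor <;> linarith
          rw [this, Real.volume_Icc, show f θ + 1 - (f θ - 1) = 2 by ring]
          simp
      _ = _ := by simp
  rw [lineMeasure, Measure.smul_apply, Measure.map_apply measurable_lineOf
    (measurableSet_hitting_box z), smul_eq_mul]
  have hpi : ENNReal.ofReal Real.pi ≠ 0 := by simp [Real.pi_pos]
  calc _ ≤ (ENNReal.ofReal Real.pi)⁻¹ * (2 * ENNReal.ofReal Real.pi) := by
        gcongr
        exact (measure_mono hsub).trans hprod
    _ = 2 := by
        rw [mul_comm, mul_assoc, ENNReal.mul_inv_cancel hpi ENNReal.ofReal_ne_top, mul_one]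

/-- Directions in an interval of length `1 / 4` that keep at least half of the dominating
coordinate `i`. -/
theorem exists_good_directions (i : Fin 2) :
    ∃ a : ℝ, 0 ≤ a ∧ a + 1 / 4 < Real.pi ∧ ∀ θ ∈ Set.Icc a (a + 1 / 4), ∀ X : Space 2,
      (∀ j, |X j| ≤ |X i|) →
        X i / 2 ∈ Set.uIcc 0 (X 0 * Real.cos θ + X 1 * Real.sin θ) := by
  have key : ∀ x y c s : ℝ, |y| ≤ |x| → 3 / 4 ≤ c → |s| ≤ 1 / 4 →
      x / 2 ∈ Set.uIcc 0 (x * c + y * s) := fun x y c s hyx hc hs => by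
    have hys : |y * s| ≤ |x| * (1 / 4) := by
      rw [abs_mul]
      gcongr
    have := abs_le.1 hys
    rw [Set.mem_uIcc]
    rcases le_total 0 x with h | h
    · rw [abs_of_nonneg h] at this
      left
      constructor <;> nlinarith
    · rw [abs_of_nonpos h] at this
      right
      constructor <;> nlinarith
  have htrig : ∀ t ∈ Set.Icc (0 : ℝ) (1 / 4), 3 / 4 ≤ Real.cos t ∧ |Real.sin t| ≤ 1 / 4 :=
    fun t ht => by
      have h1 := Real.one_sub_sq_div_two_le_cos (x := t)
      have h2 := Real.abs_sin_le_abs (x := t)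
      rw [abs_of_nonneg ht.1] at h2
      exact ⟨by nlinarith [ht.1, ht.2], h2.trans ht.2⟩
  have hpi := Real.pi_gt_three
  fin_cases i
  · refine ⟨0, le_rfl, by linarith, fun θ hθ X hX => ?_⟩
    obtain ⟨hc, hs⟩ := htrig θ (by simpa using hθ)
    exact key _ _ _ _ (hX 1) hc hs
  -- Reflecting `θ` to `π / 2 - θ` exchanges sine and cosine, and with them the two coordinates.
  · refine ⟨Real.pi / 2 - 1 / 4, by linarith, by linarith, fun θ hθ X hX => ?_⟩
    obtain ⟨hc, hs⟩ := htrig (Real.pi / 2 - θ) ⟨by linarith [hθ.2], by linarith [hθ.1]⟩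
    rw [Real.cos_pi_div_two_sub] at hc
    rw [Real.sin_pi_div_two_sub] at hs
    rw [add_comm]
    exact key _ _ _ _ (hX 0) hc hs

/-- For each good direction the projection of the connected set `boxes A` is an interval containing
`0` and the projection of the far point `X`, hence everything between `0` and `X i / 2`. This gives
a rectangle of lines of measure at least `π⁻¹ * (1 / 4) * (√n / 4)` with `n = A.card`, and `π ≤ 4`.
-/
theorem le_lineMeasure_hitting_outerBoundary {A : Finset (Lattice 2)} (h0 : 0 ∈ A)
    (hA : IsPreconnected (boxes A)) :
    ENNReal.ofReal (Real.sqrt A.card / 64) ≤ lineMeasure (hitting (boxes (outerBoundary A))) := by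
  obtain ⟨X, hX, i, hmax, hXi⟩ := exists_far_point ⟨0, h0⟩
  obtain ⟨a, ha0, ha, hdir⟩ := exists_good_directions i
  have hO : embed 0 ∈ boxes A := mem_boxes.2 ⟨0, h0, embed_mem_box 0⟩
  have hsub : Set.Icc a (a + 1 / 4) ×ˢ Set.uIcc 0 (X i / 2) ⊆
      lineOf ⁻¹' hitting (boxes (outerBoundary A)) := by
    rintro ⟨θ, p⟩ ⟨hθ, hp⟩
    refine lineOf_mem_hitting_outerBoundary ?_
    have himg : IsPreconnected
        ((fun x : Space 2 => x 0 * Real.cos θ + x 1 * Real.sin θ) '' boxes A) :=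
      hA.image _ (by fun_prop)
    have hp' : p ∈ Set.uIcc 0 (X 0 * Real.cos θ + X 1 * Real.sin θ) :=
      Set.uIcc_subset_uIcc_left (hdir θ hθ X hmax) hp
    obtain ⟨x, hx, hxp⟩ := himg.ordConnected.uIcc_subset
      ⟨embed 0, hO, by simp [embed_apply]⟩ ⟨X, hX, rfl⟩ hp'
    exact ⟨x, (mem_lineOf _ _).2 hxp, hx⟩
  have hrect : ENNReal.ofReal (1 / 4) * ENNReal.ofReal (|X i| / 2) ≤
      ((volume.restrict (Set.Ico (0 : ℝ) Real.pi)).prod (volume : Measure ℝ))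
        (lineOf ⁻¹' hitting (boxes (outerBoundary A))) := by
    refine le_trans (le_of_eq ?_) (measure_mono hsub)
    rw [Measure.prod_prod, Measure.restrict_apply measurableSet_Icc,
      Set.inter_eq_left.2 (Set.Icc_subset_Ico_iff (by linarith) |>.2 ⟨ha0, ha⟩), Real.volume_Icc,
      Real.volume_interval]
    simp [abs_div]
  rw [lineMeasure, Measure.smul_apply, smul_eq_mul]
  refine le_trans ?_ (mul_le_mul_right
    (hrect.trans (Measure.le_map_apply measurable_lineOf.aemeasurable _)) _)
  rw [← ENNReal.ofReal_inv_of_pos Real.pi_pos, ← ENNReal.ofReal_mul (by positivity),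
    ← ENNReal.ofReal_mul (by positivity)]
  refine ENNReal.ofReal_le_ofReal ?_
  have hpi : (1 / 4 : ℝ) ≤ Real.pi⁻¹ := by
    rw [one_div]
    exact inv_anti₀ Real.pi_pos Real.pi_le_four
  calc Real.sqrt A.card / 64 = 1 / 4 * (1 / 4 * (Real.sqrt A.card / 2 / 2)) := by ring
    _ ≤ _ := by gcongr

/-! ## Estimates for the ballistic measure -/

theorem weight_le_indicator (v : Line 2 → Space 2) (A : Finset (Lattice 2)) (z : Lattice 2)
    (L : Line 2) : weight v A z L ≤ (hitting (box z)).indicator 1 L := by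
  classical
  have key : z ∈ visited A L → (1 : ℝ≥0∞) ≤ (hitting (box z)).indicator 1 L := fun h => by
    have hL : L ∈ hitting (box z) := (Finset.mem_filter.1 h).2
    rw [Set.indicator_of_mem hL]
    rfl
  unfold weight
  split_ifs with h1 h2
  · exact key (h1 ▸ Finset.mem_singleton_self z)
  · exact le_trans (by simp) (key (h2.2.elim (fun h => h.1) fun h => h.1))
  · exact zero_le

theorem ballisticMeasure_eq_zero (v : Line 2 → Space 2) {A : Finset (Lattice 2)} {z : Lattice 2}
    (hz : z ∉ A) : ballisticMeasure v A z = 0 := by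
  classical
  have hv : ∀ L, z ∉ visited A L := fun L h => hz (Finset.mem_filter.1 h).1
  have : ∀ L, weight v A z L = 0 := fun L => by
    have h1 : visited A L ≠ {z} := fun h => hv L (h ▸ Finset.mem_singleton_self z)
    have h2 : ¬(1 < (visited A L).card ∧ (IsFirst v A L z ∨ IsLast v A L z)) :=
      fun h => h.2.elim (fun h => hv L h.1) fun h => hv L h.1
    rw [weight, if_neg h1, if_neg h2]
  simp [ballisticMeasure, this]

theorem ballisticMeasure_outerBoundary_le (v : Line 2 → Space 2) {A : Finset (Lattice 2)}
    (h0 : 0 ∈ A) (hA : IsPreconnected (boxes A)) (z : Lattice 2) :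
    ballisticMeasure v (outerBoundary A) z ≤ ENNReal.ofReal (128 / Real.sqrt A.card) := by
  have hcard : 0 < Real.sqrt A.card :=
    Real.sqrt_pos.2 (Nat.cast_pos.2 (Finset.card_pos.2 ⟨0, h0⟩))
  calc ballisticMeasure v (outerBoundary A) z
      ≤ ∫⁻ L, (hitting (box z)).indicator 1 L ∂isotropicLaw (boxes (outerBoundary A)) :=
        lintegral_mono fun L => weight_le_indicator v _ z L
    _ = isotropicLaw (boxes (outerBoundary A)) (hitting (box z)) :=
        lintegral_indicator_one (measurableSet_hitting_box z)
    _ ≤ (ENNReal.ofReal (Real.sqrt A.card / 64))⁻¹ * 2 := by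
        rw [isotropicLaw, ProbabilityTheory.cond, Measure.smul_apply, smul_eq_mul]
        exact mul_le_mul' (ENNReal.inv_le_inv.2 (le_lineMeasure_hitting_outerBoundary h0 hA))
          ((Measure.restrict_apply_le _ _).trans (lineMeasure_hitting_box_le z))
    _ = ENNReal.ofReal (128 / Real.sqrt A.card) := by
        rw [← ENNReal.ofReal_inv_of_pos (by positivity), ← ENNReal.ofReal_ofNat 2,
          ← ENNReal.ofReal_mul (by positivity)]
        congr 1
        field_simp
        norm_num

/-! ## The exponential functional -/

/-- The functional `∑_{x ∈ A} exp ‖x‖`. -/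
noncomputable def expSum {d : ℕ} (A : Finset (Lattice d)) : ℝ≥0∞ :=
  ∑ x ∈ A, ENNReal.ofReal (Real.exp ‖embed x‖)

theorem expSum_insert_le {d : ℕ} (A : Finset (Lattice d)) (y : Lattice d) :
    expSum (insert y A) ≤ expSum A + ENNReal.ofReal (Real.exp ‖embed y‖) := by
  by_cases hy : y ∈ A
  · rw [Finset.insert_eq_of_mem hy]
    exact le_self_add
  · rw [expSum, Finset.sum_insert hy, add_comm, expSum]

theorem Adj.mem_Icc {d : ℕ} {x y : Lattice d} (h : Adj x y) : y ∈ Finset.Icc (x - 1) (x + 1) := by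
  have key : ∀ i, |x i - y i| ≤ 1 := fun i => by
    have hi := PiLp.norm_apply_le (embed x - embed y) i
    rw [h] at hi
    have : |((x i - y i : ℤ) : ℝ)| ≤ 1 := by simpa [embed] using hi
    exact_mod_cast this
  rw [Finset.mem_Icc]
  constructor <;> intro i <;> have := abs_le.1 (key i) <;> simp <;> omega

theorem sum_biUnion_le {ι κ : Type*} [DecidableEq κ] (s : Finset ι) (t : ι → Finset κ)
    (f : κ → ℝ≥0∞) : ∑ y ∈ s.biUnion t, f y ≤ ∑ x ∈ s, ∑ y ∈ t x, f y := by
  classical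
  induction s using Finset.induction_on with
  | empty => simp
  | insert a s ha ih =>
    rw [Finset.biUnion_insert, Finset.sum_insert ha]
    calc _ ≤ ∑ y ∈ t a ∪ s.biUnion t, f y + ∑ y ∈ t a ∩ s.biUnion t, f y := le_self_add
      _ = ∑ y ∈ t a, f y + ∑ y ∈ s.biUnion t, f y := Finset.sum_union_inter
      _ ≤ _ := by gcongr

/-- A neighbour costs a factor `e < 3` in the exponential, and a point has at most `9` neighbours by
the crude count of a 3 × 3 block. -/
theorem expSum_outerBoundary_le (A : Finset (Lattice 2)) :
    expSum (outerBoundary A) ≤ 27 * expSum A := by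
  classical
  let N : Lattice 2 → Finset (Lattice 2) := fun x => {y ∈ Finset.Icc (x - 1) (x + 1) | Adj x y}
  have hN : ∀ x, (N x).card ≤ 9 := fun x => by
    refine (Finset.card_filter_le _ _).trans ?_
    simp [Pi.card_Icc, Fin.prod_univ_two, Int.card_Icc, show x 0 + 1 + 1 - (x 0 - 1) = 3 by ring,
      show x 1 + 1 + 1 - (x 1 - 1) = 3 by ring]
  have hsub : outerBoundary A ⊆ A.biUnion N := fun y hy => by
    obtain ⟨-, x, hx, hxy⟩ := mem_outerBoundary.1 hy
    exact Finset.mem_biUnion.2 ⟨x, hx, Finset.mem_filter.2 ⟨hxy.mem_Icc, hxy⟩⟩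
  have hexp : ∀ x, ∀ y ∈ N x, ENNReal.ofReal (Real.exp ‖embed y‖) ≤
      3 * ENNReal.ofReal (Real.exp ‖embed x‖) := fun x y hy => by
    have hxy : ‖embed x - embed y‖ = 1 := (Finset.mem_filter.1 hy).2
    have hle : ‖embed y‖ ≤ 1 + ‖embed x‖ := by
      rw [← hxy, norm_sub_rev]
      linarith [norm_sub_norm_le (embed y) (embed x)]
    rw [← ENNReal.ofReal_ofNat 3, ← ENNReal.ofReal_mul (by norm_num)]
    refine ENNReal.ofReal_le_ofReal ((Real.exp_le_exp.2 hle).trans ?_)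
    rw [Real.exp_add]
    gcongr
    exact Real.exp_one_lt_three.le
  calc expSum (outerBoundary A)
      ≤ ∑ y ∈ A.biUnion N, ENNReal.ofReal (Real.exp ‖embed y‖) :=
        Finset.sum_le_sum_of_subset hsub
    _ ≤ ∑ x ∈ A, ∑ y ∈ N x, ENNReal.ofReal (Real.exp ‖embed y‖) := sum_biUnion_le A N _
    _ ≤ ∑ x ∈ A, 27 * ENNReal.ofReal (Real.exp ‖embed x‖) := by
        refine Finset.sum_le_sum fun x _ => (Finset.sum_le_card_nsmul _ _ _ (hexp x)).trans ?_
        rw [nsmul_eq_mul, ← mul_assoc]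
        gcongr
        calc ((N x).card : ℝ≥0∞) * 3 ≤ (9 : ℕ) * 3 := by
              gcongr
              exact hN x
          _ = 27 := by norm_num
    _ = 27 * expSum A := by rw [expSum, Finset.mul_sum]

/-! ## One step of ballistic aggregation -/

section Step

variable {Ω : Type*} [MeasurableSpace Ω] {P : Measure Ω}

theorem lintegral_comp_eq_tsum {α : Type*} [Countable α] {H : Ω → α}
    (hH : ∀ a, MeasurableSet {ω | H ω = a}) (φ : α → ℝ≥0∞) :
    ∫⁻ ω, φ (H ω) ∂P = ∑' a, φ a * P {ω | H ω = a} := by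
  let _ : MeasurableSpace α := ⊤
  have hm : Measurable H := measurable_to_countable' hH
  rw [← lintegral_map measurable_from_top hm, lintegral_countable']
  exact tsum_congr fun a => by rw [Measure.map_apply hm (measurableSet_singleton a)]; rfl

variable {v : Line 2 → Space 2} {F : ℕ → Ω → Finset (Lattice 2)}

theorem IsBallisticAggregation.measurableSet_eq (hF : IsBallisticAggregation v P F) {n : ℕ}
    (hn : 1 ≤ n) (A : Finset (Lattice 2)) : MeasurableSet {ω | F n ω = A} :=
  hF.measurable n hn (t := {A}) trivial

theorem IsBallisticAggregation.measurable_expSum (hF : IsBallisticAggregation v P F) {n : ℕ}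
    (hn : 1 ≤ n) : Measurable fun ω => expSum (F n ω) :=
  fun s _ => hF.measurable n hn (t := expSum ⁻¹' s) trivial

variable [IsProbabilityMeasure P]

/-- The product form of the joint law also covers sets `A` of probability zero, where conditioning
says nothing. -/
theorem IsBallisticAggregation.exists_step (hF : IsBallisticAggregation v P F) {n : ℕ}
    (hn : 1 ≤ n) : ∃ y : Ω → Lattice 2, Measurable y ∧
      (∀ ω, F (n + 1) ω = insert (y ω) (F n ω)) ∧
      ∀ A z, P {ω | F n ω = A ∧ y ω = z} =
        ballisticMeasure v (outerBoundary A) z * P {ω | F n ω = A} := by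
  obtain ⟨y, hy, hins, hcond⟩ := hF.step n hn
  refine ⟨y, hy, hins, fun A z => ?_⟩
  by_cases h0 : P {ω | F n ω = A} = 0
  · rw [h0, mul_zero]
    exact measure_mono_null (fun ω hω => hω.1) h0
  · rw [← hcond A h0 z, cond_mul_eq_inter (hF.measurableSet_eq hn A)]
    rfl

/-- Almost surely, `F n` consists of `n` points, contains the origin and is connected. -/
theorem IsBallisticAggregation.ae_cluster (hF : IsBallisticAggregation v P F) {n : ℕ}
    (hn : 1 ≤ n) :
    ∀ᵐ ω ∂P, 0 ∈ F n ω ∧ (F n ω).card = n ∧ IsPreconnected (boxes (F n ω)) := by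
  induction n, hn using Nat.le_induction with
  | base =>
    refine ae_of_all _ fun ω => ?_
    rw [hF.start ω]
    refine ⟨by simp, by simp, ?_⟩
    simpa [boxes] using (convex_box (0 : Lattice 2)).isPreconnected
  | succ n hn ih =>
    obtain ⟨y, -, hins, hjoint⟩ := hF.exists_step hn
    have hy : ∀ᵐ ω ∂P, ∀ A z, z ∉ outerBoundary A → ¬(F n ω = A ∧ y ω = z) := by
      refine ae_all_iff.2 fun A => ae_all_iff.2 fun z => ?_
      by_cases hz : z ∈ outerBoundary A
      · exact ae_of_all _ fun ω h => absurd hz h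
      · have : P {ω | F n ω = A ∧ y ω = z} = 0 := by
          rw [hjoint, ballisticMeasure_eq_zero v hz, zero_mul]
        filter_upwards [measure_eq_zero_iff_ae_notMem.1 this] with ω hω _ using hω
    filter_upwards [ih, hy] with ω ⟨h0, hcard, hconn⟩ hyω
    have hmem : y ω ∈ outerBoundary (F n ω) := by
      by_contra h
      exact hyω _ _ h ⟨rfl, rfl⟩
    rw [hins]
    exact ⟨Finset.mem_insert_of_mem h0,
      by rw [Finset.card_insert_of_notMem (mem_outerBoundary.1 hmem).1, hcard],
      isPreconnected_boxes_insert hconn hmem⟩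

/-- Given `F n = A`, the added term has mean at most `128 / √n * expSum (outerBoundary A)`, and
`3456 = 27 * 128`. -/
theorem IsBallisticAggregation.lintegral_expSum_succ_le (hF : IsBallisticAggregation v P F)
    {n : ℕ} (hn : 1 ≤ n) :
    ∫⁻ ω, expSum (F (n + 1) ω) ∂P ≤
      ENNReal.ofReal (1 + 3456 / Real.sqrt n) * ∫⁻ ω, expSum (F n ω) ∂P := by
  obtain ⟨y, hy, hins, hjoint⟩ := hF.exists_step hn
  have hFn := hF.measurableSet_eq hn
  have hmeas := hF.measurable_expSum hn
  have hpair : ∀ a : Finset (Lattice 2) × Lattice 2, {ω | (F n ω, y ω) = a} =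
      {ω | F n ω = a.1 ∧ y ω = a.2} := fun a => by
    ext ω
    exact Prod.ext_iff
  have hnew : ∫⁻ ω, ENNReal.ofReal (Real.exp ‖embed (y ω)‖) ∂P ≤
      ENNReal.ofReal (3456 / Real.sqrt n) * ∫⁻ ω, expSum (F n ω) ∂P := by
    rw [lintegral_comp_eq_tsum (H := fun ω => (F n ω, y ω)) (fun a => by
        rw [hpair]
        exact (hFn a.1).inter (hy (measurableSet_singleton a.2)))
        (fun a => ENNReal.ofReal (Real.exp ‖embed a.2‖)),
      lintegral_comp_eq_tsum hFn expSum, ← ENNReal.tsum_mul_left,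
      ENNReal.tsum_prod (f := fun A z => ENNReal.ofReal (Real.exp ‖embed z‖) *
        P {ω | (F n ω, y ω) = (A, z)})]
    refine ENNReal.tsum_le_tsum fun A => ?_
    simp only [hpair, hjoint]
    by_cases hA0 : P {ω | F n ω = A} = 0
    · simp [hA0]
    -- A value `A` taken with positive probability inherits the almost sure properties of the
    -- cluster.
    obtain ⟨ω, rfl, h0, hcard, hconn⟩ : ∃ ω, F n ω = A ∧ 0 ∈ F n ω ∧ (F n ω).card = n ∧
        IsPreconnected (boxes (F n ω)) := by
      have hfreq : ∃ᵐ ω ∂P, F n ω = A := frequently_ae_iff.2 hA0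
      exact (hfreq.and_eventually (hF.ae_cluster hn)).exists
    generalize F n ω = A at *
    rw [tsum_eq_sum (s := outerBoundary A) fun z hz => by
      rw [ballisticMeasure_eq_zero v hz, zero_mul, mul_zero]]
    calc ∑ z ∈ outerBoundary A, ENNReal.ofReal (Real.exp ‖embed z‖) *
          (ballisticMeasure v (outerBoundary A) z * P {ω | F n ω = A})
        ≤ ∑ z ∈ outerBoundary A, ENNReal.ofReal (Real.exp ‖embed z‖) *
          (ENNReal.ofReal (128 / Real.sqrt n) * P {ω | F n ω = A}) := by
          refine Finset.sum_le_sum fun z _ => ?_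
          gcongr
          rw [← hcard]
          exact ballisticMeasure_outerBoundary_le v h0 hconn z
      _ = expSum (outerBoundary A) *
          (ENNReal.ofReal (128 / Real.sqrt n) * P {ω | F n ω = A}) := by
          rw [expSum, Finset.sum_mul]
      _ ≤ 27 * expSum A * (ENNReal.ofReal (128 / Real.sqrt n) * P {ω | F n ω = A}) := by
          gcongr
          exact expSum_outerBoundary_le A
      _ = 27 * ENNReal.ofReal (128 / Real.sqrt n) * (expSum A * P {ω | F n ω = A}) := by ring
      _ = _ := by
          rw [← ENNReal.ofReal_ofNat 27, ← ENNReal.ofReal_mul (by norm_num), mul_div_assoc']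
          norm_num
  calc ∫⁻ ω, expSum (F (n + 1) ω) ∂P
      ≤ ∫⁻ ω, (expSum (F n ω) + ENNReal.ofReal (Real.exp ‖embed (y ω)‖)) ∂P :=
        lintegral_mono fun ω => by
          rw [hins]
          exact expSum_insert_le _ _
    _ = ∫⁻ ω, expSum (F n ω) ∂P + ∫⁻ ω, ENNReal.ofReal (Real.exp ‖embed (y ω)‖) ∂P :=
        lintegral_add_left hmeas _
    _ ≤ _ := by
        rw [ENNReal.ofReal_add zero_le_one (by positivity), ENNReal.ofReal_one, add_mul, one_mul]
        gcongr

theorem IsBallisticAggregation.lintegral_expSum_le (hF : IsBallisticAggregation v P F)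
    {n : ℕ} (hn : 1 ≤ n) :
    ∫⁻ ω, expSum (F n ω) ∂P ≤ ENNReal.ofReal (Real.exp (13824 * Real.sqrt n)) := by
  induction n, hn using Nat.le_induction with
  | base =>
    have : ∀ ω, expSum (F 1 ω) = 1 := fun ω => by
      have h0 : embed (0 : Lattice 2) = 0 := by
        ext i
        simp [embed_apply]
      simp [hF.start ω, expSum, h0]
    simp [this]
  | succ n hn ih =>
    refine (hF.lintegral_expSum_succ_le hn).trans ((mul_le_mul_right ih _).trans ?_)
    rw [← ENNReal.ofReal_mul (by positivity)]
    refine ENNReal.ofReal_le_ofReal ?_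
    have hn' : (1 : ℝ) ≤ n := by exact_mod_cast hn
    have hs : 0 < Real.sqrt n := Real.sqrt_pos.2 (by linarith)
    have hs2 := Real.sq_sqrt (show (0 : ℝ) ≤ n by linarith)
    have hs' : 0 ≤ Real.sqrt (n + 1 : ℝ) := Real.sqrt_nonneg _
    have hs2' := Real.sq_sqrt (show (0 : ℝ) ≤ n + 1 by linarith)
    have hle : Real.sqrt (n + 1 : ℝ) ≤ 2 * Real.sqrt n := by nlinarith
    -- This gap makes the product of the factors `1 + 3456 / √k` telescope in the exponent, with
    -- `13824 = 4 * 3456`.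
    have hgap : 1 / Real.sqrt n ≤ 4 * (Real.sqrt (n + 1 : ℝ) - Real.sqrt n) := by
      rw [div_le_iff₀ hs]
      nlinarith
    push_cast
    calc (1 + 3456 / Real.sqrt n) * Real.exp (13824 * Real.sqrt n)
        ≤ Real.exp (3456 / Real.sqrt n) * Real.exp (13824 * Real.sqrt n) := by
          gcongr
          linarith [Real.add_one_le_exp (3456 / Real.sqrt n)]
      _ = Real.exp (3456 / Real.sqrt n + 13824 * Real.sqrt n) := (Real.exp_add _ _).symm
      _ ≤ _ := by
          refine Real.exp_le_exp.2 ?_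
          rw [show 3456 / Real.sqrt n = 3456 * (1 / Real.sqrt n) by ring]
          linarith

/-- Markov's inequality: the farthest point alone contributes `exp (rad (F n))` to `expSum`. The
constant `13825 = 13824 + 1` leaves the summable factor `exp (-√n)`. -/
theorem IsBallisticAggregation.measure_rad_ge_le (hF : IsBallisticAggregation v P F)
    {n : ℕ} (hn : 1 ≤ n) :
    P {ω | (F n ω).Nonempty ∧ 13825 * Real.sqrt n ≤ rad (F n ω)} ≤
      ENNReal.ofReal (Real.exp (-Real.sqrt n)) := by
  have hmeas := hF.measurable_expSum hn
  have hpos : ENNReal.ofReal (Real.exp (13825 * Real.sqrt n)) ≠ 0 := by simp [Real.exp_pos]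
  calc _ ≤ P {ω | ENNReal.ofReal (Real.exp (13825 * Real.sqrt n)) ≤ expSum (F n ω)} := by
        refine measure_mono ?_
        rintro ω ⟨hne, hω⟩
        obtain ⟨x, hx, hxr⟩ := exists_norm_eq_rad hne
        refine (ENNReal.ofReal_le_ofReal (Real.exp_le_exp.2 (hω.trans hxr.ge))).trans ?_
        exact Finset.single_le_sum
          (f := fun x : Lattice 2 => ENNReal.ofReal (Real.exp ‖embed x‖)) (fun _ _ => zero_le) hx
    _ ≤ (∫⁻ ω, expSum (F n ω) ∂P) / ENNReal.ofReal (Real.exp (13825 * Real.sqrt n)) :=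
        meas_ge_le_lintegral_div hmeas.aemeasurable hpos ENNReal.ofReal_ne_top
    _ ≤ ENNReal.ofReal (Real.exp (13824 * Real.sqrt n)) /
          ENNReal.ofReal (Real.exp (13825 * Real.sqrt n)) := by
        gcongr
        exact hF.lintegral_expSum_le hn
    _ = _ := by
        rw [← ENNReal.ofReal_div_of_pos (Real.exp_pos _), ← Real.exp_sub]
        congr 2
        ring

theorem summable_exp_neg_sqrt : Summable fun n : ℕ => Real.exp (-Real.sqrt n) := by
  -- The comparison with `24 / n ^ 2` fails at `n = 0`, where the quotient is `0` by convention.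
  rw [← summable_nat_add_iff 1]
  have hsum : Summable fun n : ℕ => 24 * (1 / ((n + 1 : ℕ) : ℝ) ^ 2) :=
    ((summable_nat_add_iff 1).2 (Real.summable_one_div_nat_pow.2 one_lt_two)).mul_left 24
  refine Summable.of_nonneg_of_le (fun n => (Real.exp_pos _).le) (fun n => ?_) hsum
  have hpos : (0 : ℝ) < (n + 1 : ℕ) := by positivity
  have h := Real.pow_div_factorial_le_exp _ (Real.sqrt_nonneg ((n + 1 : ℕ) : ℝ)) 4
  rw [show Real.sqrt ((n + 1 : ℕ) : ℝ) ^ 4 = (Real.sqrt ((n + 1 : ℕ) : ℝ) ^ 2) ^ 2 by ring,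
    Real.sq_sqrt hpos.le, show ((Nat.factorial 4 : ℕ) : ℝ) = 24 by norm_num [Nat.factorial]] at h
  rw [Real.exp_neg]
  refine (inv_anti₀ (by positivity) h).trans (le_of_eq ?_)
  rw [inv_div]
  ring

/-- Almost surely, the radius of `F n` is eventually at most a constant multiple of `√n`. -/
theorem IsBallisticAggregation.ae_eventually_rad_lt (hF : IsBallisticAggregation v P F) :
    ∀ᵐ ω ∂P, ∀ᶠ n : ℕ in atTop, (F n ω).Nonempty → rad (F n ω) < 13825 * Real.sqrt n := by
  -- Borel–Cantelli; the condition `1 ≤ n` discards the unconstrained `F 0`.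
  have hfin : ∑' n : ℕ, P {ω | 1 ≤ n ∧ (F n ω).Nonempty ∧
      13825 * Real.sqrt n ≤ rad (F n ω)} ≠ ∞ := by
    refine ne_top_of_le_ne_top summable_exp_neg_sqrt.tsum_ofReal_ne_top
      (ENNReal.tsum_le_tsum fun n => ?_)
    by_cases hn : 1 ≤ n
    · exact (measure_mono fun ω hω => hω.2).trans (hF.measure_rad_ge_le hn)
    · simp [hn]
  filter_upwards [ae_eventually_notMem hfin] with ω hω
  filter_upwards [hω, eventually_ge_atTop 1] with n hn hn1 hne
  by_contra h
  exact hn ⟨hn1, hne, not_lt.1 h⟩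

end Step

/-! ### Logarithmic asymptotics and conclusion -/

theorem tendsto_log_div_log_of_sqrt_bounds {r : ℕ → ℝ} {c K : ℝ} (hc : 0 < c)
    (hlow : ∀ᶠ n : ℕ in atTop, c * Real.sqrt n ≤ r n)
    (hupp : ∀ᶠ n : ℕ in atTop, r n ≤ K * Real.sqrt n) :
    Tendsto (fun n : ℕ => Real.log n / Real.log (r n)) atTop (𝓝 2) := by
  have hlog : Tendsto (fun n : ℕ => Real.log (n : ℝ)) atTop atTop :=
    Real.tendsto_log_atTop.comp tendsto_natCast_atTop_atTop
  have hlim : ∀ b : ℝ, Tendsto (fun n : ℕ => 1 / 2 + Real.log b / Real.log (n : ℝ)) atTop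
      (𝓝 (1 / 2)) := fun b => by
    simpa using (tendsto_const_nhds (x := (1 / 2 : ℝ))).add (hlog.const_div_atTop (Real.log b))
  have hsplit : ∀ b : ℝ, 0 < b → ∀ n : ℕ, 1 ≤ n → 0 < Real.log (n : ℝ) →
      Real.log (b * Real.sqrt n) / Real.log n = 1 / 2 + Real.log b / Real.log (n : ℝ) :=
    fun b hb n hn hl => by
      have hn' : (0 : ℝ) < n := by exact_mod_cast hn
      rw [Real.log_mul hb.ne' (Real.sqrt_pos.2 hn').ne', Real.log_sqrt hn'.le]
      field_simp
      ring
  -- The reciprocal quotient is squeezed, since its denominator does not involve `r`; the constants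
  -- `c` and `K` vanish on division by `log n`.
  have hhalf : Tendsto (fun n : ℕ => Real.log (r n) / Real.log (n : ℝ)) atTop (𝓝 (1 / 2)) := by
    refine tendsto_of_tendsto_of_tendsto_of_le_of_le' (hlim c) (hlim K) ?_ ?_
    · filter_upwards [hlow, eventually_ge_atTop 1, hlog.eventually_gt_atTop 0] with n h hn hl
      have hn' : 0 < Real.sqrt (n : ℝ) := Real.sqrt_pos.2 (by exact_mod_cast hn)
      rw [← hsplit c hc n hn hl]
      gcongr
    · filter_upwards [hlow, hupp, eventually_ge_atTop 1, hlog.eventually_gt_atTop 0]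
        with n h h' hn hl
      have hn' : 0 < Real.sqrt (n : ℝ) := Real.sqrt_pos.2 (by exact_mod_cast hn)
      have hr : 0 < r n := (mul_pos hc hn').trans_le h
      have hK : 0 < K := pos_of_mul_pos_left (hr.trans_le h') hn'.le
      rw [← hsplit K hK n hn hl]
      gcongr
  have hinv := hhalf.inv₀ (by norm_num)
  simpa using hinv

end BallisticAggregation

theorem mainTheorem2 {Ω : Type*} [MeasurableSpace Ω] (P : Measure Ω) [IsProbabilityMeasure P]
    (v : BallisticAggregation.Line 2 → BallisticAggregation.Space 2)
    (hv : BallisticAggregation.IsDirectionField v)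
    (F : ℕ → Ω → Finset (BallisticAggregation.Lattice 2))
    (hF : BallisticAggregation.IsBallisticAggregation v P F) :
    ∀ᵐ ω ∂P,
      BallisticAggregation.HasFractalDimension (fun n => F n ω) 2 ∧
      Tendsto (fun n : ℕ => Real.log (n : ℝ) / Real.log (BallisticAggregation.rad (F n ω)))
        atTop (𝓝 2) := by
  have hcluster : ∀ᵐ ω ∂P, ∀ n : ℕ, 1 ≤ n → 0 ∈ F n ω ∧ (F n ω).card = n := by
    refine ae_all_iff.2 fun n => ?_
    by_cases hn : 1 ≤ n
    · filter_upwards [hF.ae_cluster hn] with ω hω _ using ⟨hω.1, hω.2.1⟩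
    · exact ae_of_all _ fun ω h => absurd h hn
  filter_upwards [hcluster, hF.ae_eventually_rad_lt] with ω hω hrad
  have hlim : Tendsto
      (fun n : ℕ => Real.log (n : ℝ) / Real.log (BallisticAggregation.rad (F n ω)))
      atTop (𝓝 2) := by
    refine BallisticAggregation.tendsto_log_div_log_of_sqrt_bounds (c := 1 / 4) (K := 13825)
      (by norm_num) ?_ ?_
    -- From `n = 4` on, `√n ≥ 2` turns `(√n - 1) / 2` into at least `√n / 4`.
    · filter_upwards [eventually_ge_atTop 4] with n hn
      obtain ⟨h0, hcard⟩ := hω n (by omega)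
      have h := BallisticAggregation.sqrt_card_le_rad ⟨0, h0⟩
      rw [hcard] at h
      have h2 : (2 : ℝ) ≤ Real.sqrt n :=
        Real.le_sqrt_of_sq_le (by norm_num; exact_mod_cast hn)
      linarith
    · filter_upwards [hrad, eventually_ge_atTop 1] with n h hn
      exact (h ⟨0, (hω n hn).1⟩).le
  refine ⟨hlim.congr' ?_, hlim⟩
  filter_upwards [eventually_ge_atTop 1] with n hn
  rw [(hω n hn).2]
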